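/- Let $n\ge 0$, $0<t_1<T$, $\Omega=(0,T)\times\mathbb{R}^n$. Let $H\in C^1([0,T]\times\mathbb{R}^n)$ and let $\sigma:\mathbb{R}^n\to\mathbb{R}$ be convex and (globally) Lipschitz. For $f:\mathbb{R}^n\to(-\infty,+\infty]$ write $f^*(x)=\sup_{q\in\mathbb{R}^n}\{\langle x,q\rangle-f(q)\}$. Consider the layered solution of the Cauchy problem $u_t+H(t,D_xu)=0$ in $\Omega$, $u(0,\cdot)=\sigma$, i.e. the function $$u(t,x)=\begin{cases}\big(\sigma^*+\int_0^tH(\tau,\cdot)\,d\tau\big)^*(x), & (t,x)\in[0,t_1]\times\mathbb{R}^n,\\[2pt] \big((u(t_1,\cdot))^*+\int_{t_1}^tH(\tau,\cdot)\,d\tau\big)^*(x), & (t,x)\in[t_1,T]\times\mathbb{R}^n.\end{cases}$$ Say that $H$ satisfies (A2) on $[a,b]\times\mathbb{R}^n$ if one of the following holds: (a) $H(t,\cdot)$ is convex for all $t\in[a,b]$, or $H(t,\cdot)$ is concave for all $t\in[a,b]$; (b) $H(t,p)=g(t)h(p)+k(t)$ on $[a,b]\times\mathbb{R}^n$ for some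 real-valued functions $g,h,k$, where either $g\ge0$ on $[a,b]$ or $g\le0$ on $[a,b]$. Let $\Sigma(u)$ be the set of singular points of $u$, i.e. of the points of $\Omega$ at which $u$ is not differentiable (as a function of $(t,x)$). **Theorem 4.5.** Suppose that (A2) holds on $[0,t_1]\times\mathbb{R}^n$ and on $[t_1,T]\times\mathbb{R}^n$. Let $(t_0,x_0)\in\Sigma(u)$, and assume that the zero level set $\{(p,q)\in\mathbb{R}\times\mathbb{R}^n : p+H(t_0,q)=0\}$ contains no line segment $[(p_1,q_1),(p_2,q_2)]$ with $(p_1,q_1)\ne(p_2,q_2)$. Then there are $\rho>0$ and a Lipschitz arc $\mathbf{x}:[0,\rho]\to\mathbb{R}^{n+1}$ such that $\mathbf{x}(0)=(t_0,x_0)$, $\mathbf{x}(s)\in\Sigma(u)$ for every $s\in(0,\rho)$, and $\mathbf{x}(s)\neq(t_0,x_0)$ for all sufficiently small $s>0$. -/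

import Mathlib

open Set Filter Topology MeasureTheory
open scoped NNReal

noncomputable section

namespace HopfLayer

variable {n : ℕ}

/-- The Fenchel conjugate `f*(x) = sup_q {⟨x, q⟩ - f(q)}` of an extended-real-valued function. -/
def conj (f : EuclideanSpace ℝ (Fin n) → EReal) (x : EuclideanSpace ℝ (Fin n)) : EReal :=
  ⨆ q : EuclideanSpace ℝ (Fin n), ((inner ℝ x q : ℝ) : EReal) - f q

/-- The Hopf-type formula with initial time `a` and initial datum `σ`:
`(t, x) ↦ (σ* + ∫_a^t H(τ, ·) dτ)*(x)`, with values in the extended reals. -/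
def hopfE (H : ℝ → EuclideanSpace ℝ (Fin n) → ℝ) (a : ℝ) (σ : EuclideanSpace ℝ (Fin n) → ℝ)
    (t : ℝ) (x : EuclideanSpace ℝ (Fin n)) : EReal :=
  conj (fun q => conj (fun y => (σ y : EReal)) q + ((∫ τ in a..t, H τ q : ℝ) : EReal)) x

/-- The real-valued Hopf-type formula. For `σ` convex and Lipschitz and `H` continuous
on `[a, t] × ℝⁿ`, the extended real `hopfE H a σ t x` is finite. -/
def hopf (H : ℝ → EuclideanSpace ℝ (Fin n) → ℝ) (a : ℝ) (σ : EuclideanSpace ℝ (Fin n) → ℝ)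
    (t : ℝ) (x : EuclideanSpace ℝ (Fin n)) : ℝ :=
  (hopfE H a σ t x).toReal

/-- The layered solution with layers `[0, t₁]` and `[t₁, T]`: the Hopf-type formula for `(H, σ)`
up to time `t₁`, then the Hopf-type formula started at time `t₁` from the datum `u(t₁, ·)`. -/
def layered (H : ℝ → EuclideanSpace ℝ (Fin n) → ℝ) (σ : EuclideanSpace ℝ (Fin n) → ℝ) (t₁ : ℝ)
    (z : ℝ × EuclideanSpace ℝ (Fin n)) : ℝ :=
  if z.1 ≤ t₁ then hopf H 0 σ z.1 z.2 else hopf H t₁ (hopf H 0 σ t₁) z.1 z.2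

/-- The structural condition on the Hamiltonian on `[a, b] × ℝⁿ`: either `H(t, ·)` is convex for all `t ∈ [a, b]`, or it is
concave for all `t ∈ [a, b]`, or `H(t, p) = g(t) h(p) + k(t)` where `g` keeps its sign. -/
def CondA2 (H : ℝ → EuclideanSpace ℝ (Fin n) → ℝ) (a b : ℝ) : Prop :=
  (∀ t ∈ Icc a b, ConvexOn ℝ univ (H t)) ∨
  (∀ t ∈ Icc a b, ConcaveOn ℝ univ (H t)) ∨
  ∃ (g : ℝ → ℝ) (h : EuclideanSpace ℝ (Fin n) → ℝ) (k : ℝ → ℝ),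
    (∀ t ∈ Icc a b, ∀ p, H t p = g t * h p + k t) ∧
    ((∀ t ∈ Icc a b, 0 ≤ g t) ∨ (∀ t ∈ Icc a b, g t ≤ 0))

/-- The singular set of `u` in `Ω = (0, T) × ℝⁿ`: the points of `Ω` where `u` is not
differentiable (jointly in `(t, x)`). -/
def singularSet (T : ℝ) (u : ℝ × EuclideanSpace ℝ (Fin n) → ℝ) :
    Set (ℝ × EuclideanSpace ℝ (Fin n)) :=
  {z | z.1 ∈ Ioo 0 T ∧ ¬ DifferentiableAt ℝ u z}

end HopfLayer

end

/-! Since `H` is Lipschitz in time for momenta in the ball of radius `L`, the function `w = u + C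
t²` is convex. More precisely, at every `(t, x)` it has a subgradient of the form `(2Ct - H(t, q),
q)` (`exists_support_layered`). These pairs form a closed relation `M`, which over each point is a
graph over `q`.

At a singular point the subdifferential `S` of `w` is compact, convex and has at least two points.
Its boundary cannot lie entirely in `M`. If `S` has empty interior, `M` would contain a segment,
contrary to the hypothesis on the zero level set. If not, a line in the time direction through an
interior point leaves `S` at two boundary points with the same `q`, which a graph forbids. So some
boundary point `P₀` of `S` is off `M`.

A resolvent curve leaving the point along a normal to `S` at `P₀` carries subgradients tending to
`P₀`. If `w` were differentiable at a nearby point of the curve, its only subgradient there would be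
in `M`, yet it is near `P₀` and `M` is closed. Hence the curve is singular for small parameters. -/

namespace HopfLayer

/-! ### Subgradients of convex functions and resolvent curves. -/

section Subgradient

variable {V : Type*} [NormedAddCommGroup V] [InnerProductSpace ℝ V]

/-- `P` is a subgradient of `w` at `x`. -/
def IsSubgradient (w : V → ℝ) (x P : V) : Prop :=
  ∀ y, w x + inner ℝ P (y - x) ≤ w y

theorem mem_of_tendsto_of_mapClusterPt {ι X Y : Type*} [TopologicalSpace X] [TopologicalSpace Y]
    {C : Set (X × Y)} (hC : IsClosed C) {l : Filter ι} {f : ι → X} {g : ι → Y} {a : X} {b : Y}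
    (hf : Tendsto f l (𝓝 a)) (hg : MapClusterPt b l g) (h : ∀ᶠ i in l, (f i, g i) ∈ C) :
    (a, b) ∈ C := by
  rw [← hC.closure_eq, mem_closure_iff_nhds]
  intro t ht
  rw [nhds_prod_eq, mem_prod_iff] at ht
  obtain ⟨s₁, h₁, s₂, h₂, hs⟩ := ht
  obtain ⟨i, hi₂, hi₁, hi⟩ :=
    ((mapClusterPt_iff_frequently.1 hg s₂ h₂).and_eventually ((hf.eventually_mem h₁).and h)).exists
  exact ⟨(f i, g i), hs ⟨hi₁, hi₂⟩, hi⟩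

theorem convexOn_of_forall_exists_isSubgradient {w : V → ℝ}
    (h : ∀ x, ∃ P, IsSubgradient w x P) : ConvexOn ℝ univ w := by
  refine ⟨convex_univ, fun x _ y _ a b ha hb hab => ?_⟩
  obtain ⟨P, hP⟩ := h (a • x + b • y)
  have h1 := mul_le_mul_of_nonneg_left (hP x) ha
  have h2 := mul_le_mul_of_nonneg_left (hP y) hb
  have h3 : a * inner ℝ P (x - (a • x + b • y)) + b * inner ℝ P (y - (a • x + b • y)) = 0 := by
    simp only [inner_sub_right, inner_add_right, inner_smul_right]
    obtain rfl : b = 1 - a := by linarith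
    ring
  obtain rfl : b = 1 - a := by linarith
  simp only [smul_eq_mul]
  linarith

theorem isClosed_setOf_isSubgradient {w : V → ℝ} (hw : Continuous w) :
    IsClosed {z : V × V | IsSubgradient w z.1 z.2} := by
  simp only [IsSubgradient, ofPred_forall]
  refine isClosed_iInter fun y => isClosed_le ?_ continuous_const
  fun_prop

theorem convex_setOf_isSubgradient (w : V → ℝ) (x : V) :
    Convex ℝ {P | IsSubgradient w x P} := by
  intro P hP Q hQ a b ha hb hab y
  have h1 := mul_le_mul_of_nonneg_left (hP y) ha
  have h2 := mul_le_mul_of_nonneg_left (hQ y) hb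
  simp only [inner_add_left, real_inner_smul_left]
  obtain rfl : b = 1 - a := by linarith
  linarith

theorem IsSubgradient.inner_sub_nonneg {w : V → ℝ} {x y P Q : V} (hP : IsSubgradient w x P)
    (hQ : IsSubgradient w y Q) : 0 ≤ inner ℝ (P - Q) (x - y) := by
  have h1 := hP y
  have h2 := hQ x
  have : inner ℝ (P - Q) (x - y) = - inner ℝ P (y - x) - inner ℝ Q (x - y) := by
    rw [inner_sub_left, ← neg_sub y x, inner_neg_right, inner_neg_right]
  linarith

theorem IsSubgradient.eq_of_hasFDerivAt {w : V → ℝ} {x P : V} {f : V →L[ℝ] ℝ}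
    (hP : IsSubgradient w x P) (hf : HasFDerivAt w f x) : f = innerSL ℝ P := by
  have hmin : IsLocalMin (fun y => w y - innerSL ℝ P y) x := by
    refine Eventually.of_forall fun y => ?_
    have := hP y
    simp only [innerSL_apply_apply, inner_sub_right] at this ⊢
    linarith
  have := hmin.hasFDerivAt_eq_zero (hf.sub (innerSL ℝ P).hasFDerivAt)
  exact sub_eq_zero.1 this

theorem IsSubgradient.eq_of_differentiableAt {w : V → ℝ} {x P Q : V}
    (hP : IsSubgradient w x P) (hQ : IsSubgradient w x Q) (hd : DifferentiableAt ℝ w x) :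
    P = Q := by
  have h : innerSL ℝ P = innerSL ℝ Q :=
    (hP.eq_of_hasFDerivAt hd.hasFDerivAt).symm.trans (hQ.eq_of_hasFDerivAt hd.hasFDerivAt)
  refine ext_inner_right ℝ fun v => ?_
  simpa using congrArg (fun f => f v) h

variable [FiniteDimensional ℝ V]

theorem exists_norm_le_of_isSubgradient {w : V → ℝ} (hw : Continuous w) (x₀ : V) :
    ∃ B, ∀ x ∈ Metric.closedBall x₀ 1, ∀ P, IsSubgradient w x P → ‖P‖ ≤ B := by
  obtain ⟨B, hB⟩ := (isCompact_closedBall x₀ (2 : ℝ)).exists_bound_of_continuousOn hw.continuousOn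
  refine ⟨2 * B, fun x hx P hP => ?_⟩
  have hx' : dist x x₀ ≤ 1 := hx
  have hwx := hB x (Metric.closedBall_subset_closedBall (by norm_num) hx)
  rcases eq_or_ne P 0 with rfl | hne
  · simpa using (norm_nonneg _).trans hwx
  have hn : ‖P‖ ≠ 0 := norm_ne_zero_iff.2 hne
  -- A unit step along `P` raises `w` by at least `‖P‖`, while `|w|` is bounded on the ball of
  -- radius 2.
  set y := x + ‖P‖⁻¹ • P with hy
  have hyb : y ∈ Metric.closedBall x₀ 2 := by
    have : dist y x ≤ 1 := by
      rw [dist_eq_norm, hy, add_sub_cancel_left, norm_smul, norm_inv, norm_norm, inv_mul_cancel₀ hn]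
    rw [Metric.mem_closedBall]
    linarith [dist_triangle y x x₀]
  have hwy := hB y hyb
  have := hP y
  rw [hy, add_sub_cancel_left, real_inner_smul_right, real_inner_self_eq_norm_sq, ← hy] at this
  have h2 : ‖P‖⁻¹ * ‖P‖ ^ 2 = ‖P‖ := by field_simp
  rw [Real.norm_eq_abs, abs_le] at hwx hwy
  linarith

/-- If the subgradient `P x₀` were unique, local boundedness and closedness would make any selection
`P` continuous at `x₀`. The remainder of the expansion at `x₀` lies between `0` and `⟨P x - P x₀, x
- x₀⟩`, so it would be `o(‖x - x₀‖)`. -/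
theorem exists_ne_isSubgradient_of_not_differentiableAt {w : V → ℝ} (hw : Continuous w)
    (hex : ∀ x, ∃ P, IsSubgradient w x P) {x₀ : V} (hd : ¬ DifferentiableAt ℝ w x₀) :
    ∃ A B, A ≠ B ∧ IsSubgradient w x₀ A ∧ IsSubgradient w x₀ B := by
  by_contra! hcon
  choose P hP using hex
  apply hd
  obtain ⟨B, hB⟩ := exists_norm_le_of_isSubgradient hw x₀
  have hball : ∀ᶠ x in 𝓝 x₀, x ∈ Metric.closedBall x₀ 1 := Metric.closedBall_mem_nhds _ one_pos
  have hlim : Tendsto P (𝓝 x₀) (𝓝 (P x₀)) := by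
    refine (isCompact_closedBall (0 : V) B).tendsto_nhds_of_unique_mapClusterPt ?_ ?_
    · filter_upwards [hball] with x hx
      simpa using hB x hx _ (hP x)
    · intro y _ hy
      by_contra hne
      exact hcon y (P x₀) hne (mem_of_tendsto_of_mapClusterPt (isClosed_setOf_isSubgradient hw)
        tendsto_id hy (Eventually.of_forall hP)) (hP x₀)
  refine HasFDerivAt.differentiableAt (f' := innerSL ℝ (P x₀)) ?_
  rw [hasFDerivAt_iff_isLittleO, Asymptotics.isLittleO_iff]
  intro c hc
  filter_upwards [(Metric.tendsto_nhds.1 hlim) c hc] with x hx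
  have h1 := hP x₀ x
  have h2 := hP x x₀
  have h3 : inner ℝ (P x - P x₀) (x - x₀) = - inner ℝ (P x) (x₀ - x) - inner ℝ (P x₀) (x - x₀) := by
    rw [inner_sub_left, ← neg_sub x x₀, inner_neg_right, neg_neg]
  have h4 : inner ℝ (P x - P x₀) (x - x₀) ≤ c * ‖x - x₀‖ := by
    refine (real_inner_le_norm _ _).trans ?_
    gcongr
    rw [← dist_eq_norm]
    exact hx.le
  rw [innerSL_apply_apply, Real.norm_eq_abs, abs_of_nonneg (by linarith)]
  linarith

/-- The inclusion is the first-order condition at a minimizer of `y ↦ w (x₀ + s y) + (s/2)‖y - a‖²`.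
The subgradient `P₀` supplies the coercivity. -/
theorem exists_isSubgradient_resolvent {w : V → ℝ} (hconv : ConvexOn ℝ univ w)
    (hw : Continuous w) {x₀ P₀ : V} (hP₀ : IsSubgradient w x₀ P₀) (a : V) {s : ℝ} (hs : 0 < s) :
    ∃ y, IsSubgradient w (x₀ + s • y) (a - y) := by
  have hcont : Continuous fun y => w (x₀ + s • y) + (s / 2) * ‖y - a‖ ^ 2 := by fun_prop
  obtain ⟨y, hy⟩ := hcont.exists_forall_le' 0 <| by
    filter_upwards [(tendsto_norm_cocompact_atTop (E := V)).eventually_ge_atTop (2 * ‖P₀ - a‖)]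
      with y hy
    have h1 := hP₀ (x₀ + s • y)
    rw [add_sub_cancel_left, real_inner_smul_right] at h1
    have h2 : ‖y - a‖ ^ 2 = ‖y‖ ^ 2 - 2 * inner ℝ y a + ‖a‖ ^ 2 := norm_sub_sq_real y a
    have h3 := abs_le.1 (abs_real_inner_le_norm (P₀ - a) y)
    rw [inner_sub_left, real_inner_comm] at h3
    have h4 : 0 ≤ ‖y‖ * (‖y‖ - 2 * ‖P₀ - a‖) := mul_nonneg (norm_nonneg _) (by linarith)
    have h5 : 0 ≤ s * (inner ℝ P₀ y - inner ℝ y a + ‖y‖ ^ 2 / 2) :=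
      mul_nonneg hs.le (by rw [real_inner_comm P₀ y] at *; nlinarith [h3.1, real_inner_comm a y])
    simp only [smul_zero, add_zero, zero_sub, norm_neg, h2]
    nlinarith
  refine ⟨y, fun z => ?_⟩
  set v := s⁻¹ • (z - x₀) - y with hv
  have hz : z = x₀ + s • (y + v) := by
    rw [hv, add_sub_cancel, smul_inv_smul₀ hs.ne', add_sub_cancel]
  -- Compare the minimizer `y` with `y + t v`, bound `w` by convexity and divide by `t`; then `t →
  -- 0`.
  have key : ∀ t ∈ Ioo (0 : ℝ) 1,
      0 ≤ w z - w (x₀ + s • y) + s * inner ℝ v (y - a) + s / 2 * ‖v‖ ^ 2 * t := by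
    intro t ht
    have h1 := hy (y + t • v)
    have h2 := hconv.2 (mem_univ (x₀ + s • y)) (mem_univ z) (sub_nonneg.2 ht.2.le) ht.1.le
      (by ring)
    have h3 : (1 - t) • (x₀ + s • y) + t • z = x₀ + s • (y + t • v) := by
      rw [hz]; module
    have h4 : ‖y + t • v - a‖ ^ 2 = ‖y - a‖ ^ 2 + 2 * (t * inner ℝ v (y - a)) + t ^ 2 * ‖v‖ ^ 2 := by
      rw [show y + t • v - a = (y - a) + t • v by abel, norm_add_sq_real, real_inner_smul_right,
        real_inner_comm, norm_smul, mul_pow, Real.norm_eq_abs, sq_abs]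
    rw [h3] at h2
    rw [h4] at h1
    simp only [smul_eq_mul] at h2
    refine nonneg_of_mul_nonneg_right (?_ : 0 ≤ t * _) ht.1
    nlinarith
  have hlim : Tendsto (fun t : ℝ => w z - w (x₀ + s • y) + s * inner ℝ v (y - a) +
      s / 2 * ‖v‖ ^ 2 * t) (𝓝[>] 0) (𝓝 (w z - w (x₀ + s • y) + s * inner ℝ v (y - a) +
      s / 2 * ‖v‖ ^ 2 * 0)) := by
    refine tendsto_nhdsWithin_of_tendsto_nhds (Continuous.tendsto ?_ _)
    fun_prop
  have h0 := ge_of_tendsto hlim (by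
    filter_upwards [Ioo_mem_nhdsGT (zero_lt_one' ℝ)] with t ht using key t ht)
  have h5 : inner ℝ (a - y) (z - (x₀ + s • y)) = - (s * inner ℝ v (y - a)) := by
    rw [show z - (x₀ + s • y) = s • v by rw [hz]; module, real_inner_smul_right,
      real_inner_comm, ← neg_sub y a, inner_neg_right, mul_neg]
  rw [h5]
  linarith

/-- With nonempty interior this is Hahn–Banach; otherwise `S` spans a proper affine subspace, and
any nonzero vector orthogonal to it serves. -/
theorem exists_normal_of_notMem_interior {S : Set V} (hS : Convex ℝ S) {p : V} (hp : p ∈ S)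
    (hpi : p ∉ interior S) : ∃ ν : V, ν ≠ 0 ∧ ∀ q ∈ S, inner ℝ ν (q - p) ≤ 0 := by
  by_cases hi : (interior S).Nonempty
  · obtain ⟨f, hf, hfS⟩ := geometric_hahn_banach_of_nonempty_interior_point hS hpi hi
    refine ⟨(InnerProductSpace.toDual ℝ V).symm f, by simpa using hf, fun q hq => ?_⟩
    rw [InnerProductSpace.toDual_symm_apply, map_sub]
    linarith [hfS q hq]
  · have hne : (affineSpan ℝ S).direction ≠ ⊤ := by
      rw [Ne, AffineSubspace.direction_eq_top_iff_of_nonempty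
        ⟨p, subset_affineSpan ℝ S hp⟩, ← hS.interior_nonempty_iff_affineSpan_eq_top]
      exact hi
    have hne' : (affineSpan ℝ S).directionᗮ ≠ ⊥ := by
      rwa [Ne, Submodule.orthogonal_eq_bot_iff]
    obtain ⟨ν, hν, hν0⟩ := Submodule.exists_mem_ne_zero_of_ne_bot hne'
    refine ⟨ν, hν0, fun q hq => ?_⟩
    rw [real_inner_comm]
    refine (Submodule.inner_right_of_mem_orthogonal ?_ hν).le
    exact AffineSubspace.vsub_mem_direction (subset_affineSpan ℝ S hq) (subset_affineSpan ℝ S hp)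

/-- Resolvent curve issuing from `x₀` in the direction of a normal `ν` to the
subdifferential of a convex function at `x₀`, taken at a boundary point `P₀`. -/
theorem exists_lipschitz_curve_isSubgradient {w : V → ℝ} (hconv : ConvexOn ℝ univ w)
    (hw : Continuous w) {x₀ P₀ ν : V} (hP₀ : IsSubgradient w x₀ P₀) (hν : ν ≠ 0)
    (hnormal : ∀ P, IsSubgradient w x₀ P → inner ℝ ν (P - P₀) ≤ 0) :
    ∃ (γ P : ℝ → V), LipschitzOnWith ‖ν‖₊ γ (Ici 0) ∧ γ 0 = x₀ ∧
      (∀ s, 0 < s → IsSubgradient w (γ s) (P s)) ∧ Tendsto P (𝓝[>] 0) (𝓝 P₀) ∧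
      ∀ᶠ s in 𝓝[>] (0 : ℝ), γ s ≠ x₀ := by
  have hex : ∀ s : ℝ, ∃ y, 0 < s → IsSubgradient w (x₀ + s • y) (P₀ + ν - y) := by
    intro s
    by_cases hs : 0 < s
    · obtain ⟨y, hy⟩ := exists_isSubgradient_resolvent hconv hw hP₀ (P₀ + ν) hs
      exact ⟨y, fun _ => hy⟩
    · exact ⟨0, fun h => absurd h hs⟩
  choose y hy using hex
  -- Monotonicity of the subdifferential between `x₀ + s y` and `x₀`.
  have hinner : ∀ s, 0 < s → ‖y s‖ ^ 2 ≤ inner ℝ ν (y s) := by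
    intro s hs
    have := (hy s hs).inner_sub_nonneg hP₀
    rw [add_sub_cancel_left, show P₀ + ν - y s - P₀ = ν - y s by abel, real_inner_smul_right,
      inner_sub_left, real_inner_self_eq_norm_sq] at this
    linarith [nonneg_of_mul_nonneg_right this hs]
  have hnorm : ∀ s, 0 < s → ‖y s‖ ≤ ‖ν‖ := by
    intro s hs
    have h1 := (hinner s hs).trans (real_inner_le_norm _ _)
    rcases (norm_nonneg (y s)).eq_or_lt with h0 | h0
    · rw [← h0]; positivity
    · rw [sq] at h1
      exact le_of_mul_le_mul_right h1 h0
  have hmap0 : Tendsto (fun s => x₀ + s • y s) (𝓝[>] 0) (𝓝 x₀) := by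
    have h : Tendsto (fun s : ℝ => s • y s) (𝓝[>] 0) (𝓝 0) := by
      refine squeeze_zero_norm' (a := fun s => s * ‖ν‖) ?_ ?_
      · filter_upwards [self_mem_nhdsWithin] with s hs
        have hs : 0 < s := hs
        rw [norm_smul, Real.norm_eq_abs, abs_of_pos hs]
        exact mul_le_mul_of_nonneg_left (hnorm s hs) hs.le
      · refine tendsto_nhdsWithin_of_tendsto_nhds ?_
        have : Continuous fun s : ℝ => s * ‖ν‖ := by fun_prop
        simpa using this.tendsto 0
    simpa using tendsto_const_nhds.add h
  -- For a cluster point `z`, `P₀ + ν - z` is a subgradient at `x₀`, so normality gives `⟨ν, ν - z⟩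
  -- ≤ 0`. With `‖z‖ ≤ ‖ν‖` this forces `z = ν`.
  have hlim : Tendsto y (𝓝[>] 0) (𝓝 ν) := by
    refine (isCompact_closedBall (0 : V) ‖ν‖).tendsto_nhds_of_unique_mapClusterPt ?_ ?_
    · filter_upwards [self_mem_nhdsWithin] with s hs
      simpa using hnorm s hs
    · intro z hzB hz
      have hcl : IsClosed {p : V × V | IsSubgradient w p.1 (P₀ + ν - p.2)} :=
        (isClosed_setOf_isSubgradient hw).preimage
          (f := fun p : V × V => (p.1, P₀ + ν - p.2)) (by fun_prop)
      have hsub : IsSubgradient w x₀ (P₀ + ν - z) :=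
        mem_of_tendsto_of_mapClusterPt hcl hmap0 hz (by
          filter_upwards [self_mem_nhdsWithin] with s hs using hy s hs)
      have h1 := hnormal _ hsub
      rw [show P₀ + ν - z - P₀ = ν - z by abel, inner_sub_right, real_inner_self_eq_norm_sq] at h1
      have h2 : ‖z‖ ≤ ‖ν‖ := by simpa using hzB
      have h3 : ‖z - ν‖ ^ 2 = ‖z‖ ^ 2 - 2 * inner ℝ z ν + ‖ν‖ ^ 2 := norm_sub_sq_real z ν
      have h4 : ‖z‖ ^ 2 ≤ ‖ν‖ ^ 2 := by gcongr
      rw [real_inner_comm] at h3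
      have h5 : ‖z - ν‖ ^ 2 ≤ 0 := by linarith
      exact sub_eq_zero.1 (norm_eq_zero.1 (pow_eq_zero_iff two_ne_zero |>.1
        (le_antisymm h5 (sq_nonneg _))))
  refine ⟨fun s => x₀ + s • (if 0 < s then y s else 0), fun s => P₀ + ν - y s, ?_, by simp, ?_,
    ?_, ?_⟩
  · refine LipschitzOnWith.of_dist_le_mul fun s hs r hr => ?_
    have hs0 : (0 : ℝ) ≤ s := hs
    have hr0 : (0 : ℝ) ≤ r := hr
    simp only [coe_nnnorm, dist_add_left]
    rcases hs0.eq_or_lt with rfl | hs0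
    · rcases hr0.eq_or_lt with rfl | hr0
      · simp
      · simp only [hr0, if_true, zero_smul, dist_zero_left, norm_smul, mul_comm]
        gcongr
        exact hnorm r hr0
    rcases hr0.eq_or_lt with rfl | hr0
    · simp only [hs0, if_true, zero_smul, dist_zero_right, norm_smul, mul_comm]
      gcongr
      exact hnorm s hs0
    simp only [hs0, hr0, if_true]
    have hm := (hy s hs0).inner_sub_nonneg (hy r hr0)
    rw [dist_eq_norm, Real.dist_eq]
    set d := s • y s - r • y r with hd
    have e1 : x₀ + s • y s - (x₀ + r • y r) = d := by rw [hd]; abel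
    have e2 : s • (P₀ + ν - y s - (P₀ + ν - y r)) = (s - r) • y r - d := by rw [hd]; module
    -- Monotonicity between the two curve points, multiplied by `s`.
    have h1 : ‖d‖ ^ 2 ≤ inner ℝ ((s - r) • y r) d := by
      rw [e1] at hm
      have := mul_nonneg hs0.le hm
      rw [← real_inner_smul_left, e2, inner_sub_left, real_inner_self_eq_norm_sq] at this
      linarith
    have h2 : ‖d‖ ^ 2 ≤ ‖(s - r) • y r‖ * ‖d‖ := h1.trans (real_inner_le_norm _ _)
    have h3 : ‖d‖ ≤ ‖(s - r) • y r‖ := by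
      rcases (norm_nonneg d).eq_or_lt with h0 | h0
      · rw [← h0]; positivity
      · rw [sq] at h2
        exact le_of_mul_le_mul_right h2 h0
    rw [norm_smul, Real.norm_eq_abs, mul_comm] at h3
    exact h3.trans (mul_le_mul_of_nonneg_right (hnorm r hr0) (abs_nonneg _))
  · intro s hs
    simpa [hs] using hy s hs
  · simpa using (tendsto_const_nhds (x := P₀ + ν)).sub hlim
  · filter_upwards [self_mem_nhdsWithin, hlim.eventually_ne hν] with s hs hne h
    have hs : 0 < s := hs
    simp [hs, hs.ne', hne] at h

/-- Propagation of singularities for a convex function with a closed relation `M` that holds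
for some subgradient at each point. -/
theorem exists_lipschitz_singular_curve {w : V → ℝ} {M : Set (V × V)} (hM : IsClosed M)
    (hex : ∀ x, ∃ P, IsSubgradient w x P ∧ (x, P) ∈ M) {x₀ P₀ : V}
    (hP₀ : IsSubgradient w x₀ P₀) (hP₀i : P₀ ∉ interior {P | IsSubgradient w x₀ P})
    (hP₀M : (x₀, P₀) ∉ M) :
    ∃ (γ : ℝ → V) (K : ℝ≥0), LipschitzOnWith K γ (Ici 0) ∧ γ 0 = x₀ ∧
      (∀ᶠ s in 𝓝[>] (0 : ℝ), ¬ DifferentiableAt ℝ w (γ s)) ∧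
      ∀ᶠ s in 𝓝[>] (0 : ℝ), γ s ≠ x₀ := by
  have hconv := convexOn_of_forall_exists_isSubgradient fun x => (hex x).imp fun P hP => hP.1
  have hw : Continuous w := hconv.locallyLipschitz.continuous
  obtain ⟨ν, hν, hnormal⟩ := exists_normal_of_notMem_interior
    (convex_setOf_isSubgradient w x₀) hP₀ hP₀i
  obtain ⟨γ, P, hγL, hγ0, hP, hPlim, hne⟩ :=
    exists_lipschitz_curve_isSubgradient hconv hw hP₀ hν hnormal
  refine ⟨γ, _, hγL, hγ0, ?_, hne⟩
  have hγlim : Tendsto γ (𝓝[>] 0) (𝓝 x₀) := by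
    have := (hγL.continuousOn 0 self_mem_Ici).tendsto
    rw [hγ0] at this
    exact this.mono_left (nhdsWithin_mono _ Ioi_subset_Ici_self)
  have hMev := (hγlim.prodMk_nhds hPlim).eventually (hM.isOpen_compl.mem_nhds hP₀M)
  filter_upwards [hMev, self_mem_nhdsWithin] with s hs hs0 hd
  obtain ⟨A, hA, hAM⟩ := hex (γ s)
  exact hs ((hP s hs0).eq_of_differentiableAt hA hd ▸ hAM)

end Subgradient

end HopfLayer

namespace HopfLayer

/-! ### Hopf formulas and supporting functions of the layered solution. -/

section Hopf

variable {n : ℕ}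

/-- The epigraph of the Fenchel conjugate of a real-valued function. -/
def conjEpigraph (σ : EuclideanSpace ℝ (Fin n) → ℝ) : Set (EuclideanSpace ℝ (Fin n) × ℝ) :=
  {p | ∀ y, inner ℝ p.1 y - σ y ≤ p.2}

theorem conj_coe_le_coe_iff {σ : EuclideanSpace ℝ (Fin n) → ℝ} {q : EuclideanSpace ℝ (Fin n)}
    {r : ℝ} : conj (fun y => (σ y : EReal)) q ≤ (r : EReal) ↔ (q, r) ∈ conjEpigraph σ := by
  simp only [conj, iSup_le_iff, conjEpigraph, mem_ofPred_eq, ← EReal.coe_sub, EReal.coe_le_coe_iff]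

theorem isClosed_conjEpigraph (σ : EuclideanSpace ℝ (Fin n) → ℝ) :
    IsClosed (conjEpigraph σ) := by
  simp only [conjEpigraph, ofPred_forall]
  refine isClosed_iInter fun y => isClosed_le ?_ ?_ <;> fun_prop

theorem conjEpigraph_nonempty {σ : EuclideanSpace ℝ (Fin n) → ℝ} (hσ : ConvexOn ℝ univ σ) :
    (conjEpigraph σ).Nonempty := by
  obtain ⟨l, c, hlc, -⟩ := hσ.exists_affine_le_of_lt (𝕜 := ℝ) (x := 0) (a := σ 0 - 1)
    (mem_univ _) (by linarith) isClosed_univ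
    (hσ.locallyLipschitz.continuous.lowerSemicontinuous.lowerSemicontinuousOn univ)
  refine ⟨((InnerProductSpace.toDual ℝ _).symm l, -c), fun y => ?_⟩
  have := hlc ⟨y, mem_univ y⟩
  simp at this
  rw [InnerProductSpace.toDual_symm_apply]
  linarith

/-- Along `y = k p.1` the pairing grows like `k‖p.1‖²` but `σ` at most like `k L ‖p.1‖`. -/
theorem norm_le_of_mem_conjEpigraph {σ : EuclideanSpace ℝ (Fin n) → ℝ} {L : ℝ≥0}
    (hL : LipschitzWith L σ) {p : EuclideanSpace ℝ (Fin n) × ℝ} (hp : p ∈ conjEpigraph σ) :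
    ‖p.1‖ ≤ L := by
  by_contra! hlt
  have hpos : 0 < ‖p.1‖ * (‖p.1‖ - L) := mul_pos (L.2.trans_lt hlt) (sub_pos.2 hlt)
  obtain ⟨k, hk⟩ := exists_nat_gt ((p.2 + σ 0) / (‖p.1‖ * (‖p.1‖ - L)))
  rw [div_lt_iff₀ hpos] at hk
  have h1 := hp ((k : ℝ) • p.1)
  have h2 := hL.dist_le_mul ((k : ℝ) • p.1) 0
  rw [real_inner_smul_right, real_inner_self_eq_norm_sq] at h1
  rw [dist_zero_right, norm_smul, Real.norm_natCast, Real.dist_eq] at h2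
  have h3 := (abs_le.1 h2).2
  nlinarith

/-- Replacing `σ*(q)` by the real numbers above it turns the extended-real supremum into a real
maximum over the closed epigraph. It is attained because `‖q‖ ≤ L`, `r ≥ -σ 0`, and the objective is
at most `B - r`. -/
theorem isGreatest_conj_conj_add {σ : EuclideanSpace ℝ (Fin n) → ℝ} {L : ℝ≥0}
    (hL : LipschitzWith L σ) (hne : (conjEpigraph σ).Nonempty)
    {K : EuclideanSpace ℝ (Fin n) → ℝ} (hK : Continuous K) (x : EuclideanSpace ℝ (Fin n)) :
    IsGreatest ((fun p => inner ℝ x p.1 - p.2 - K p.1) '' conjEpigraph σ)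
      (conj (fun q => conj (fun y => (σ y : EReal)) q + (K q : EReal)) x).toReal := by
  set F : EuclideanSpace ℝ (Fin n) × ℝ → ℝ := fun p => inner ℝ x p.1 - p.2 - K p.1 with hF
  have hFc : Continuous F := by fun_prop
  obtain ⟨p₁, hp₁⟩ := hne
  obtain ⟨B, hB⟩ := (isCompact_closedBall (0 : EuclideanSpace ℝ (Fin n))
    (L : ℝ)).exists_bound_of_continuousOn
      (f := fun q => inner ℝ x q - K q) (by fun_prop)
  have hbd : ∀ p ∈ conjEpigraph σ, F p ≤ B - p.2 := by
    intro p hp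
    have := hB p.1 (by simpa using norm_le_of_mem_conjEpigraph hL hp)
    have := (abs_le.1 this).2
    simp only [hF]
    linarith
  have hlow : ∀ p ∈ conjEpigraph σ, - σ 0 ≤ p.2 := by
    intro p hp
    simpa using hp 0
  set S := conjEpigraph σ ∩ Metric.closedBall 0 (L : ℝ) ×ˢ Icc (-σ 0) (B - F p₁) with hS
  have hSc : IsCompact S :=
    ((isCompact_closedBall _ _).prod isCompact_Icc).inter_left (isClosed_conjEpigraph σ)
  have hmem : ∀ p ∈ conjEpigraph σ, F p₁ ≤ F p → p ∈ S := by
    intro p hp hle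
    refine ⟨hp, by simpa using norm_le_of_mem_conjEpigraph hL hp, hlow p hp, ?_⟩
    linarith [hbd p hp]
  obtain ⟨p₀, hp₀S, hp₀⟩ := hSc.exists_isMaxOn ⟨p₁, hmem p₁ hp₁ le_rfl⟩ hFc.continuousOn
  have hmax : ∀ p ∈ conjEpigraph σ, F p ≤ F p₀ := by
    intro p hp
    rcases le_total (F p₁) (F p) with h | h
    · exact hp₀ (hmem p hp h)
    · exact h.trans (hp₀ (hmem p₁ hp₁ le_rfl))
  have heq : conj (fun q => conj (fun y => (σ y : EReal)) q + (K q : EReal)) x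
      = ((F p₀ : ℝ) : EReal) := by
    refine le_antisymm (iSup_le fun q => ?_) ?_
    · have hbot : ((inner ℝ q 0 - σ 0 : ℝ) : EReal) ≤ conj (fun y => (σ y : EReal)) q := by
        rw [EReal.coe_sub]
        exact le_iSup (fun y => ((inner ℝ q y : ℝ) : EReal) - (σ y : EReal)) 0
      beta_reduce
      induction hc : conj (fun y => (σ y : EReal)) q with
      | bot => rw [hc] at hbot; exact absurd (le_bot_iff.1 hbot) (EReal.coe_ne_bot _)
      | top => simp
      | coe c =>
        have := hmax (q, c) (conj_coe_le_coe_iff.1 hc.le)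
        rw [← EReal.coe_add, ← EReal.coe_sub, EReal.coe_le_coe_iff]
        simp only [hF] at this ⊢
        linarith
    · refine le_trans ?_ (le_iSup _ p₀.1)
      have h1 : conj (fun y => (σ y : EReal)) p₀.1 ≤ (p₀.2 : EReal) :=
        conj_coe_le_coe_iff.2 hp₀S.1
      calc ((F p₀ : ℝ) : EReal)
          = ((inner ℝ x p₀.1 : ℝ) : EReal) - ((p₀.2 : EReal) + (K p₀.1 : EReal)) := by
            rw [← EReal.coe_add, ← EReal.coe_sub, EReal.coe_eq_coe_iff]
            simp only [hF]; ring
        _ ≤ _ := EReal.sub_le_sub le_rfl (add_le_add_left h1 _)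
  rw [heq, EReal.toReal_coe]
  exact ⟨⟨p₀, hp₀S.1, rfl⟩, forall_mem_image.2 hmax⟩

theorem hopf_congr {H H' : ℝ → EuclideanSpace ℝ (Fin n) → ℝ} {a t : ℝ}
    (h : ∀ τ ∈ uIcc a t, H τ = H' τ) (σ : EuclideanSpace ℝ (Fin n) → ℝ) :
    hopf H a σ t = hopf H' a σ t := by
  funext x
  have : ∀ q, ∫ τ in a..t, H τ q = ∫ τ in a..t, H' τ q := fun q =>
    intervalIntegral.integral_congr fun τ hτ => congrFun (h τ hτ) q
  simp only [hopf, hopfE, this]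

variable {H : ℝ → EuclideanSpace ℝ (Fin n) → ℝ} {σ : EuclideanSpace ℝ (Fin n) → ℝ} {L : ℝ≥0}

theorem isGreatest_hopf (hH : Continuous (Function.uncurry H)) (hL : LipschitzWith L σ)
    (hne : (conjEpigraph σ).Nonempty) (a t : ℝ) (x : EuclideanSpace ℝ (Fin n)) :
    IsGreatest ((fun p => inner ℝ x p.1 - p.2 - ∫ τ in a..t, H τ p.1) '' conjEpigraph σ)
      (hopf H a σ t x) := by
  refine isGreatest_conj_conj_add (K := fun q => ∫ τ in a..t, H τ q) hL hne ?_ x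
  refine intervalIntegral.continuous_parametric_intervalIntegral_of_continuous' ?_ a t
  exact hH.comp continuous_swap

theorem lipschitzWith_hopf (hH : Continuous (Function.uncurry H)) (hL : LipschitzWith L σ)
    (hne : (conjEpigraph σ).Nonempty) (a t : ℝ) : LipschitzWith L (hopf H a σ t) := by
  refine LipschitzWith.of_le_add_mul L fun x y => ?_
  obtain ⟨⟨p, hp, hpx⟩, -⟩ := isGreatest_hopf hH hL hne a t x
  have h1 := (isGreatest_hopf hH hL hne a t y).2 ⟨p, hp, rfl⟩
  have h2 : inner ℝ (x - y) p.1 ≤ L * dist x y := by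
    rw [dist_eq_norm, mul_comm]
    refine (real_inner_le_norm _ _).trans ?_
    gcongr
    exact norm_le_of_mem_conjEpigraph hL hp
  rw [inner_sub_left] at h2
  simp only at hpx h1
  linarith

theorem mem_conjEpigraph_hopf (hH : Continuous (Function.uncurry H)) (hL : LipschitzWith L σ)
    (hne : (conjEpigraph σ).Nonempty) (a t : ℝ) {p : EuclideanSpace ℝ (Fin n) × ℝ}
    (hp : p ∈ conjEpigraph σ) :
    (p.1, p.2 + ∫ τ in a..t, H τ p.1) ∈ conjEpigraph (hopf H a σ t) := by
  intro y
  have := (isGreatest_hopf hH hL hne a t y).2 ⟨p, hp, rfl⟩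
  simp only at this
  rw [real_inner_comm]
  linarith

theorem continuous_slice (hH : Continuous (Function.uncurry H)) (q : EuclideanSpace ℝ (Fin n)) :
    Continuous fun τ => H τ q :=
  hH.comp (continuous_id.prodMk continuous_const)

theorem integral_le_of_lipschitz (hH : Continuous (Function.uncurry H)) {C : ℝ}
    {q : EuclideanSpace ℝ (Fin n)} (hC0 : 0 ≤ C) (hC : ∀ s t, |H s q - H t q| ≤ C * |s - t|)
    (t s : ℝ) : ∫ τ in t..s, H τ q ≤ H t q * (s - t) + C * (s - t) ^ 2 := by
  have hi := (continuous_slice hH q).intervalIntegrable (μ := volume) t s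
  have h1 : ∫ τ in t..s, (H τ q - H t q) = (∫ τ in t..s, H τ q) - H t q * (s - t) := by
    rw [intervalIntegral.integral_sub hi intervalIntegrable_const,
      intervalIntegral.integral_const, smul_eq_mul, mul_comm]
  have h2 : ‖∫ τ in t..s, (H τ q - H t q)‖ ≤ (C * |s - t|) * |s - t| := by
    refine intervalIntegral.norm_integral_le_of_norm_le_const fun τ hτ => ?_
    refine (hC τ t).trans (mul_le_mul_of_nonneg_left ?_ hC0)
    exact abs_sub_left_of_mem_uIcc (uIoc_subset_uIcc hτ)
  rw [h1, mul_assoc, abs_mul_abs_self, Real.norm_eq_abs] at h2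
  nlinarith [(abs_le.1 h2).2]

/-- A maximizer at `(t, x)` remains a competitor at `(s, y)`. Replacing `∫_t^s H` by `H(t, q)(s -
t)` costs at most `C(s - t)²`, exactly the gap between `C s²` and its tangent at `t`. -/
theorem exists_support_hopf (hH : Continuous (Function.uncurry H)) (hL : LipschitzWith L σ)
    (hne : (conjEpigraph σ).Nonempty) {C : ℝ} (hC0 : 0 ≤ C)
    (hC : ∀ q, ‖q‖ ≤ L → ∀ s t, |H s q - H t q| ≤ C * |s - t|)
    (a t : ℝ) (x : EuclideanSpace ℝ (Fin n)) :
    ∃ q, ∀ s y, hopf H a σ t x + C * t ^ 2 + (2 * C * t - H t q) * (s - t)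
      + inner ℝ q (y - x) ≤ hopf H a σ s y + C * s ^ 2 := by
  obtain ⟨⟨p, hp, hpx⟩, -⟩ := isGreatest_hopf hH hL hne a t x
  refine ⟨p.1, fun s y => ?_⟩
  have h1 := (isGreatest_hopf hH hL hne a s y).2 ⟨p, hp, rfl⟩
  have h2 := integral_le_of_lipschitz hH hC0 (hC p.1 (norm_le_of_mem_conjEpigraph hL hp)) t s
  have h3 := intervalIntegral.integral_add_adjacent_intervals
    ((continuous_slice hH p.1).intervalIntegrable (μ := volume) a t)
    ((continuous_slice hH p.1).intervalIntegrable (μ := volume) t s)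
  rw [inner_sub_right, real_inner_comm, real_inner_comm x]
  simp only at hpx h1
  nlinarith

theorem exists_support_layered (hH : Continuous (Function.uncurry H)) (hL : LipschitzWith L σ)
    (hne : (conjEpigraph σ).Nonempty) {C : ℝ} (hC0 : 0 ≤ C)
    (hC : ∀ q, ‖q‖ ≤ L → ∀ s t, |H s q - H t q| ≤ C * |s - t|)
    (t₁ t : ℝ) (x : EuclideanSpace ℝ (Fin n)) :
    ∃ q, ∀ s y, layered H σ t₁ (t, x) + C * t ^ 2 + (2 * C * t - H t q) * (s - t)
      + inner ℝ q (y - x) ≤ layered H σ t₁ (s, y) + C * s ^ 2 := by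
  have hL₁ := lipschitzWith_hopf hH hL hne 0 t₁
  have hne₁ : (conjEpigraph (hopf H 0 σ t₁)).Nonempty := by
    obtain ⟨p, hp⟩ := hne
    exact ⟨_, mem_conjEpigraph_hopf hH hL ⟨p, hp⟩ 0 t₁ hp⟩
  -- Each competitor for the first formula, shifted by its integral up to `t₁`, competes in the
  -- second with the same value. So first-layer supports extend past `t₁`.
  have hle : ∀ s y, hopf H 0 σ s y ≤ hopf H t₁ (hopf H 0 σ t₁) s y := by
    intro s y
    obtain ⟨⟨p, hp, hpx⟩, -⟩ := isGreatest_hopf hH hL hne 0 s y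
    have h1 := (isGreatest_hopf hH hL₁ hne₁ t₁ s y).2
      ⟨_, mem_conjEpigraph_hopf hH hL hne 0 t₁ hp, rfl⟩
    have h3 := intervalIntegral.integral_add_adjacent_intervals
      ((continuous_slice hH p.1).intervalIntegrable (μ := volume) 0 t₁)
      ((continuous_slice hH p.1).intervalIntegrable (μ := volume) t₁ s)
    simp only at hpx h1
    linarith
  have heq : ∀ y, hopf H t₁ (hopf H 0 σ t₁) t₁ y = hopf H 0 σ t₁ y := by
    intro y
    refine le_antisymm ?_ (hle t₁ y)
    obtain ⟨⟨p, hp, hpx⟩, -⟩ := isGreatest_hopf hH hL₁ hne₁ t₁ t₁ y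
    have := hp y
    simp only [intervalIntegral.integral_same] at hpx
    rw [real_inner_comm] at this
    linarith
  have hfirst : ∀ t ≤ t₁, ∀ x, ∃ q, ∀ s y, layered H σ t₁ (t, x) + C * t ^ 2
      + (2 * C * t - H t q) * (s - t) + inner ℝ q (y - x) ≤
        layered H σ t₁ (s, y) + C * s ^ 2 := by
    intro t ht x
    obtain ⟨q, hq⟩ := exists_support_hopf hH hL hne hC0 hC 0 t x
    refine ⟨q, fun s y => ?_⟩
    simp only [layered, ht, if_true]
    split_ifs
    · exact hq s y
    · linarith [hq s y, hle s y]
  rcases le_or_gt t t₁ with ht | ht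
  · exact hfirst t ht x
  obtain ⟨q, hq⟩ := exists_support_hopf hH hL₁ hne₁ hC0 hC t₁ t x
  refine ⟨q, fun s y => ?_⟩
  rcases le_or_gt s t₁ with hs | hs
  · have hst : 0 < t - s := by linarith
    -- The point `(t₁, x + l (y - x))` is where the segment from `(t, x)` to `(s, y)` crosses the
    -- interface. A support there bounds its value by the convex combination of the end values; with
    -- the second-layer support from `(t, x)` this gives `l` times the claim.
    set l := (t - t₁) / (t - s) with hl
    have hl0 : 0 < l := div_pos (by linarith) hst
    have hlt : l * (s - t) = t₁ - t := by rw [hl]; field_simp; ring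
    have hl1 : l ≤ 1 := by
      rw [hl, div_le_one hst]; linarith
    clear_value l
    obtain ⟨q', hq'⟩ := hfirst t₁ le_rfl (x + l • (y - x))
    have h0 := hq t₁ (x + l • (y - x))
    have h1 := hq' t x
    have h2 := hq' s y
    rw [heq, add_sub_cancel_left, real_inner_smul_right] at h0
    rw [show x - (x + l • (y - x)) = (-l) • (y - x) by module, real_inner_smul_right] at h1
    rw [show y - (x + l • (y - x)) = (1 - l) • (y - x) by module, real_inner_smul_right] at h2
    have e0 : layered H σ t₁ (t, x) = hopf H t₁ (hopf H 0 σ t₁) t x := by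
      simp [layered, ht.not_ge]
    have e1 : layered H σ t₁ (t₁, x + l • (y - x)) = hopf H 0 σ t₁ (x + l • (y - x)) := by
      simp [layered]
    rw [e1] at h1 h2
    rw [e0] at h1 ⊢
    obtain rfl : t₁ = t + l * (s - t) := by linarith
    have h1' := mul_le_mul_of_nonneg_left h1 (sub_nonneg.2 hl1)
    have h2' := mul_le_mul_of_nonneg_left h2 hl0.le
    refine le_of_mul_le_mul_left ?_ hl0
    linarith
  · simpa only [layered, ht.not_ge, hs.not_ge, if_false] using hq s y

end Hopf

end HopfLayer

namespace HopfLayer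

/-! ### A boundary subgradient off the graph, and the singular curve. -/

section Propagation

variable {n : ℕ}

/-- Take the last parameter at which the ray from `c` is still in the compact set. -/
theorem exists_pos_add_smul_mem_diff_interior {V : Type*} [NormedAddCommGroup V]
    [NormedSpace ℝ V] {S : Set V} (hS : IsCompact S) {c v : V} (hc : c ∈ interior S)
    (hv : v ≠ 0) : ∃ r : ℝ, 0 < r ∧ c + r • v ∈ S ∧ c + r • v ∉ interior S := by
  have hcont : Continuous fun r : ℝ => c + r • v := by fun_prop
  obtain ⟨B, hB⟩ := hS.isBounded.exists_norm_le
  have hT : IsCompact {r : ℝ | c + r • v ∈ S} := by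
    refine Metric.isCompact_of_isClosed_isBounded (hS.isClosed.preimage hcont) ?_
    refine (Metric.isBounded_closedBall (x := (0 : ℝ)) (r := (B + ‖c‖) / ‖v‖)).subset
      fun r hr => ?_
    rw [mem_closedBall_zero_iff, le_div_iff₀ (norm_pos_iff.2 hv), ← norm_smul]
    have h1 := norm_sub_le (c + r • v) c
    rw [add_sub_cancel_left] at h1
    linarith [hB _ hr]
  obtain ⟨r, hr, hmax⟩ := hT.exists_isGreatest ⟨0, by simpa using interior_subset hc⟩
  have hr0 : 0 ≤ r := hmax (by simpa using interior_subset hc)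
  have hni : c + r • v ∉ interior S := by
    intro hi
    have hev : ∀ᶠ s in 𝓝[>] r, c + s • v ∈ interior S :=
      nhdsWithin_le_nhds (hcont.continuousAt.eventually (isOpen_interior.mem_nhds hi))
    obtain ⟨s, hs, hrs⟩ := (hev.and self_mem_nhdsWithin).exists
    have hsS : c + s • v ∈ S := interior_subset hs
    exact (hmax hsS).not_gt hrs
  refine ⟨r, hr0.lt_of_ne ?_, hr, hni⟩
  rintro rfl
  exact hni (by simpa using hc)

/-- Propagation of singularities for a semiconvex function whose supporting gradients can be
chosen on the graph of `-H`. -/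
theorem exists_lipschitz_singular_curve_of_support
    {u : ℝ × EuclideanSpace ℝ (Fin n) → ℝ} {H : ℝ → EuclideanSpace ℝ (Fin n) → ℝ}
    (hH : Continuous (Function.uncurry H)) {C : ℝ}
    (hsupp : ∀ t x, ∃ q, ∀ s y, u (t, x) + C * t ^ 2 + (2 * C * t - H t q) * (s - t)
      + inner ℝ q (y - x) ≤ u (s, y) + C * s ^ 2)
    {t₀ : ℝ} {x₀ : EuclideanSpace ℝ (Fin n)} (hsing : ¬ DifferentiableAt ℝ u (t₀, x₀))
    (hseg : ∀ z w : ℝ × EuclideanSpace ℝ (Fin n), z ≠ w →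
      ¬ segment ℝ z w ⊆ {y | y.1 + H t₀ y.2 = 0}) :
    ∃ (γ : ℝ → ℝ × EuclideanSpace ℝ (Fin n)) (K : ℝ≥0),
      LipschitzOnWith K γ (Ici 0) ∧ γ 0 = (t₀, x₀) ∧
      (∀ᶠ s in 𝓝[>] (0 : ℝ), ¬ DifferentiableAt ℝ u (γ s)) ∧
      ∀ᶠ s in 𝓝[>] (0 : ℝ), γ s ≠ (t₀, x₀) := by
  set e := WithLp.prodContinuousLinearEquiv 2 ℝ ℝ (EuclideanSpace ℝ (Fin n)) with he
  set w : WithLp 2 (ℝ × EuclideanSpace ℝ (Fin n)) → ℝ := fun z => u (e z) + C * (e z).1 ^ 2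
    with hw_def
  have hdiff : ∀ z, ¬ DifferentiableAt ℝ w z ↔ ¬ DifferentiableAt ℝ u (e z) := by
    intro z
    have hsq : DifferentiableAt ℝ (fun z => C * (e z).1 ^ 2) z := by fun_prop
    refine not_congr ⟨fun h => ?_, fun h => ?_⟩
    · refine e.comp_right_differentiableAt_iff.1 ?_
      refine (h.sub hsq).congr_of_eventuallyEq (Eventually.of_forall fun y => ?_)
      simp [hw_def]
    · exact (e.comp_right_differentiableAt_iff.2 h).add hsq
  set M : Set (WithLp 2 (ℝ × EuclideanSpace ℝ (Fin n)) ×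
      WithLp 2 (ℝ × EuclideanSpace ℝ (Fin n))) :=
    {p | (e p.2).1 = 2 * C * (e p.1).1 - H (e p.1).1 (e p.2).2} with hM_def
  have hM : IsClosed M := by
    refine isClosed_eq (by fun_prop) (Continuous.sub (by fun_prop) ?_)
    exact hH.comp (f := fun p : WithLp 2 (ℝ × EuclideanSpace ℝ (Fin n)) ×
      WithLp 2 (ℝ × EuclideanSpace ℝ (Fin n)) => ((e p.1).1, (e p.2).2)) (by fun_prop)
  have hex : ∀ z, ∃ P, IsSubgradient w z P ∧ (z, P) ∈ M := by
    intro z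
    obtain ⟨q, hq⟩ := hsupp (e z).1 (e z).2
    refine ⟨e.symm (2 * C * (e z).1 - H (e z).1 q, q), fun y => ?_, by simp [hM_def]⟩
    have := hq (e y).1 (e y).2
    have h2 : inner ℝ (e.symm (2 * C * (e z).1 - H (e z).1 q, q)) (y - z) =
        (2 * C * (e z).1 - H (e z).1 q) * ((e y).1 - (e z).1)
          + inner ℝ q ((e y).2 - (e z).2) := by
      rw [WithLp.prod_inner_apply]
      simp [he, mul_comm]
    rw [h2]
    simp only [hw_def]
    linarith
  have hw : Continuous w := (convexOn_of_forall_exists_isSubgradient fun x =>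
    (hex x).imp fun P hP => hP.1).locallyLipschitz.continuous
  obtain ⟨z₀, hz₀⟩ : ∃ z₀, z₀ = e.symm (t₀, x₀) := ⟨_, rfl⟩
  have hez₀ : e z₀ = (t₀, x₀) := by rw [hz₀, e.apply_symm_apply]
  set S := {P | IsSubgradient w z₀ P} with hS
  have hSconv : Convex ℝ S := convex_setOf_isSubgradient w z₀
  have hScomp : IsCompact S := by
    refine Metric.isCompact_of_isClosed_isBounded
      ((isClosed_setOf_isSubgradient hw).preimage (Continuous.prodMk_right z₀)) ?_
    obtain ⟨B, hB⟩ := exists_norm_le_of_isSubgradient hw z₀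
    exact isBounded_iff_forall_norm_le.2
      ⟨B, fun P hP => hB z₀ (Metric.mem_closedBall_self zero_le_one) P hP⟩
  obtain ⟨A, B, hAB, hA, hB⟩ := exists_ne_isSubgradient_of_not_differentiableAt hw
    (fun x => (hex x).imp fun P hP => hP.1) ((hdiff z₀).2 (by rwa [hez₀]))
  obtain ⟨P₀, hP₀S, hP₀i, hP₀M⟩ : ∃ P₀ ∈ S, P₀ ∉ interior S ∧ (z₀, P₀) ∉ M := by
    by_contra! hcon
    have hcon' : ∀ P ∈ S, P ∉ interior S → (e P).1 = 2 * C * t₀ - H t₀ (e P).2 := by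
      intro P hP hPi
      simpa [hM_def, hez₀] using hcon P hP hPi
    rcases (interior S).eq_empty_or_nonempty with hi | ⟨c, hc⟩
    · have hsub : segment ℝ A B ⊆ S := hSconv.segment_subset hA hB
      -- Subtracting `2 C t₀`, the time derivative of `C t²`, moves the segment onto the zero level
      -- set.
      refine hseg (e A - (2 * C * t₀, 0)) (e B - (2 * C * t₀, 0))
        (fun h => hAB (e.injective (sub_left_injective h))) ?_
      rintro y ⟨a, b, ha, hb, hab, rfl⟩
      have h1 := hcon' (a • A + b • B) (hsub ⟨a, b, ha, hb, hab, rfl⟩) (by simp [hi])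
      obtain rfl : b = 1 - a := by linarith
      simp only [map_add, map_smul, Prod.fst_add, Prod.snd_add, Prod.smul_fst, Prod.smul_snd,
        smul_eq_mul, mem_ofPred_eq, Prod.fst_sub, Prod.snd_sub, sub_zero] at h1 ⊢
      linarith
    · set v : WithLp 2 (ℝ × EuclideanSpace ℝ (Fin n)) := e.symm (1, 0) with hv
      have hv0 : v ≠ 0 := by
        intro h
        have := congrArg (fun z => (e z).1) h
        simp [hv] at this
      obtain ⟨r, hr, hrS, hri⟩ := exists_pos_add_smul_mem_diff_interior hScomp hc hv0
      obtain ⟨r', hr', hrS', hri'⟩ :=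
        exists_pos_add_smul_mem_diff_interior hScomp hc (neg_ne_zero.2 hv0)
      have h1 := hcon' _ hrS hri
      have h2 := hcon' _ hrS' hri'
      -- Both exit points have the momentum of `c`, so the graph equation gives them equal time
      -- components, against `r, r' > 0`.
      simp only [hv, map_add, map_smul, map_neg, e.apply_symm_apply, Prod.fst_add, Prod.snd_add,
        Prod.smul_fst, Prod.smul_snd, Prod.fst_neg, Prod.snd_neg, smul_eq_mul, neg_zero,
        smul_zero, add_zero] at h1 h2
      linarith
  obtain ⟨γ, K, hγL, hγ0, hγ, hne⟩ := exists_lipschitz_singular_curve hM hex hP₀S hP₀i hP₀M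
  have heL : LipschitzWith ‖e.toContinuousLinearMap‖₊ e := e.toContinuousLinearMap.lipschitz
  refine ⟨fun s => e (γ s), _, heL.comp_lipschitzOnWith hγL, by simp only [hγ0, hez₀], ?_, ?_⟩
  · filter_upwards [hγ] with s hs using (hdiff _).1 hs
  · filter_upwards [hne] with s hs h
    exact hs (e.injective (h.trans hez₀.symm))

end Propagation

end HopfLayer

/-! ### The theorem, by extension of the Hamiltonian to all times. -/

theorem theorem4p5 (n : ℕ) (T t₁ : ℝ) (ht₁ : t₁ ∈ Ioo 0 T)
    (H : ℝ → EuclideanSpace ℝ (Fin n) → ℝ)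
    (hH : ContDiffOn ℝ 1 (fun z : ℝ × EuclideanSpace ℝ (Fin n) => H z.1 z.2)
      (Icc 0 T ×ˢ univ))
    (σ : EuclideanSpace ℝ (Fin n) → ℝ) (hσ : ConvexOn ℝ univ σ)
    (L : ℝ≥0) (hL : LipschitzWith L σ)
    (hA : HopfLayer.CondA2 H 0 t₁) (hB : HopfLayer.CondA2 H t₁ T)
    (t₀ : ℝ) (x₀ : EuclideanSpace ℝ (Fin n))
    (hsing : (t₀, x₀) ∈ HopfLayer.singularSet T (HopfLayer.layered H σ t₁))
    (hseg : ∀ z w : ℝ × EuclideanSpace ℝ (Fin n), z ≠ w →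
      ¬ segment ℝ z w ⊆ {y | y.1 + H t₀ y.2 = 0}) :
    ∃ (ρ : ℝ) (γ : ℝ → ℝ × EuclideanSpace ℝ (Fin n)) (K : ℝ≥0),
      0 < ρ ∧ LipschitzOnWith K γ (Icc 0 ρ) ∧ γ 0 = (t₀, x₀) ∧
      (∀ s ∈ Ioo 0 ρ, γ s ∈ HopfLayer.singularSet T (HopfLayer.layered H σ t₁)) ∧
      ∀ᶠ s in 𝓝[>] (0 : ℝ), γ s ≠ (t₀, x₀) := by
  have hT : 0 ≤ T := (ht₁.1.trans ht₁.2).le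
  -- Freezing `H` outside `[0, T]` makes it continuous for all times and keeps its Lipschitz bound
  -- in time, so the convexity argument runs on the whole space; on `[0, T]` the solution is
  -- unchanged.
  set H' : ℝ → EuclideanSpace ℝ (Fin n) → ℝ := fun t => H (projIcc 0 T hT t) with hH'
  have hHeq : ∀ t ∈ Icc 0 T, H t = H' t := by
    intro t ht
    simp only [hH', projIcc_of_mem hT ht]
  have hcont : Continuous (Function.uncurry H') :=
    hH.continuousOn.comp_continuous
      (f := fun z : ℝ × EuclideanSpace ℝ (Fin n) => ((projIcc 0 T hT z.1 : ℝ), z.2))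
      ((continuous_subtype_val.comp (continuous_projIcc.comp continuous_fst)).prodMk continuous_snd)
      fun z => ⟨Subtype.coe_prop _, mem_univ _⟩
  obtain ⟨C, hC⟩ : ∃ C, LipschitzOnWith C
      (fun z : ℝ × EuclideanSpace ℝ (Fin n) => H z.1 z.2)
      (Icc 0 T ×ˢ Metric.closedBall 0 (L : ℝ)) :=
    (hH.mono (prod_mono_right (subset_univ _))).exists_lipschitzOnWith one_ne_zero
      ((convex_Icc 0 T).prod (convex_closedBall _ _))
      (isCompact_Icc.prod (isCompact_closedBall _ _))
  have hC' : ∀ q, ‖q‖ ≤ L → ∀ s t, |H' s q - H' t q| ≤ C * |s - t| := by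
    intro q hq s t
    have hq' : q ∈ Metric.closedBall (0 : EuclideanSpace ℝ (Fin n)) (L : ℝ) := by simpa using hq
    have h1 := hC.dist_le_mul ((projIcc 0 T hT s : ℝ), q) ⟨Subtype.coe_prop _, hq'⟩
      ((projIcc 0 T hT t : ℝ), q) ⟨Subtype.coe_prop _, hq'⟩
    rw [Prod.dist_eq, dist_self, max_eq_left dist_nonneg, Real.dist_eq, Real.dist_eq] at h1
    exact h1.trans (mul_le_mul_of_nonneg_left (abs_projIcc_sub_projIcc hT) C.2)
  have hlay : ∀ z : ℝ × EuclideanSpace ℝ (Fin n), z.1 ∈ Icc 0 T →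
      HopfLayer.layered H σ t₁ z = HopfLayer.layered H' σ t₁ z := by
    have hicc : ∀ {a b : ℝ}, a ∈ Icc 0 T → b ∈ Icc 0 T → ∀ τ ∈ uIcc a b, H τ = H' τ :=
      fun ha hb τ hτ => hHeq τ ((ordConnected_Icc.uIcc_subset ha hb) hτ)
    have h0 : (0 : ℝ) ∈ Icc 0 T := ⟨le_rfl, hT⟩
    have h1 : t₁ ∈ Icc 0 T := Ioo_subset_Icc_self ht₁
    intro z hz
    simp only [HopfLayer.layered, HopfLayer.hopf_congr (hicc h0 hz),
      HopfLayer.hopf_congr (hicc h0 h1), HopfLayer.hopf_congr (hicc h1 hz)]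
  have hdiff : ∀ z : ℝ × EuclideanSpace ℝ (Fin n), z.1 ∈ Ioo 0 T →
      (DifferentiableAt ℝ (HopfLayer.layered H σ t₁) z ↔
        DifferentiableAt ℝ (HopfLayer.layered H' σ t₁) z) := by
    intro z hz
    refine EventuallyEq.differentiableAt_iff ?_
    filter_upwards [continuous_fst.continuousAt.eventually (Icc_mem_nhds hz.1 hz.2)] with y hy
      using hlay y hy
  have ht₀ : t₀ ∈ Ioo 0 T := hsing.1
  obtain ⟨γ, K, hγL, hγ0, hγ, hne⟩ := HopfLayer.exists_lipschitz_singular_curve_of_support hcont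
    (HopfLayer.exists_support_layered hcont hL (HopfLayer.conjEpigraph_nonempty hσ) C.2 hC' t₁)
    (fun h => hsing.2 ((hdiff _ ht₀).2 h))
    (by rwa [← hHeq t₀ (Ioo_subset_Icc_self ht₀)])
  have hγt : ∀ᶠ s in 𝓝[>] (0 : ℝ), (γ s).1 ∈ Ioo 0 T := by
    have h := (hγL.continuousOn 0 self_mem_Ici).tendsto.mono_left
      (nhdsWithin_mono _ Ioi_subset_Ici_self)
    rw [hγ0] at h
    exact (continuous_fst.continuousAt.tendsto.comp h).eventually (Ioo_mem_nhds ht₀.1 ht₀.2)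
  obtain ⟨ρ, hρ, hsub⟩ := mem_nhdsGT_iff_exists_Ioo_subset.1 (hγ.and hγt)
  exact ⟨ρ, γ, K, hρ, hγL.mono Icc_subset_Ici_self, hγ0,
    fun s hs => ⟨(hsub hs).2, fun h => (hsub hs).1 ((hdiff _ (hsub hs).2).1 h)⟩, hne⟩
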